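/- Fix an integer $d\ge 1$. For $x,y$ in the unit sphere $\mathbf S^d\subset\mathbf R^{d+1}$ let $\rho(x,y)=\arccos(x\cdot y)$ and $\Lambda(x,y)=\frac2\pi\min\{\rho(x,y),\pi-\rho(x,y)\}$. Let $\mathcal P(\mathbf S^d)$ be the set of Borel probability measures on $\mathbf S^d$ and, for $0<\alpha<\infty$, let $$E_\alpha(\mu)=\frac12\iint \Lambda(x,y)^\alpha\,d\mu(x)\,d\mu(y),\qquad \mu\in\mathcal P(\mathbf S^d).$$ Let $\mathcal P_\Delta^=(\mathbf S^d)$ be the set of $\mu\in\mathcal P(\mathbf S^d)$ for which there are a measure $\nu\in\mathcal P(\mathbf S^d)$, whose support is an orthonormal basis of $\mathbf R^{d+1}$ with $\nu(\{x\})=\frac1{d+1}$ for each point $x$ of this basis, and a rotation $M\in SO(d+1)$ such that $\mu(A\cup -A)=\nu(M(A\cup -A))$ for each open $A\subset\mathbf S^d$. For $\mu,\nu\in\mathcal P(\mathbf S^d)$ let $$d_\infty(\mu,\nu)=\inf_{\gamma\in\Gamma(\mu,\nu)}\ \sup_{(x,y)\in\operatorname{spt}\gamma}\rho(x,y),$$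 where $\Gamma(\mu,\nu)$ is the set of Borel probability measures on $\mathbf S^d\times\mathbf S^d$ with marginals $\mu$ and $\nu$. There is a unique $\alpha_{\Delta^d}\in[0,\infty]$ such that $\mathcal P_\Delta^=(\mathbf S^d)$ is disjoint from $\operatorname{argmax}_{\mathcal P(\mathbf S^d)}E_\alpha$ for every real $\alpha$ with $0<\alpha<\alpha_{\Delta^d}$, and $\mathcal P_\Delta^=(\mathbf S^d)=\operatorname{argmax}_{\mathcal P(\mathbf S^d)}E_\alpha$ for every real $\alpha>0$ with $\alpha>\alpha_{\Delta^d}$. It satisfies $1\le\alpha_{\Delta^d}<\infty$. If $\alpha_{\Delta^d}\ne1$, then no curve $(\mu_\alpha)_{\alpha>0}$ with $\mu_\alpha\in\operatorname{argmax}_{\mathcal P(\mathbf S^d)}E_\alpha$ for all $\alpha>0$ is $d_\infty$-continuous at $\alpha=\alpha_{\Delta^d}$, that is, $d_\infty(\mu_\alpha,\mu_{\alpha_{\Delta^d}})\to0$ as $\alpha\to\alpha_{\Delta^d}$ fails. -/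

import Mathlib

open MeasureTheory Filter Topology
open scoped ENNReal RealInnerProductSpace

noncomputable section

namespace ProjectiveAngle

/-- Euclidean space of dimension `d + 1`. -/
abbrev E (d : ℕ) : Type := EuclideanSpace ℝ (Fin (d + 1))

/-- The unit sphere of dimension `d`, with its subspace topology and Borel sigma-algebra. -/
abbrev S (d : ℕ) : Type := Metric.sphere (0 : E d) 1

/-- The geodesic distance on the sphere. -/
def rho {d : ℕ} (x y : S d) : ℝ := Real.arccos ⟪(x : E d), (y : E d)⟫

/-- The profile `t ↦ (2 / π) min (t, π - t)`. -/
def Lambda0 (t : ℝ) : ℝ := 2 / Real.pi * min t (Real.pi - t)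

/-- The projective distance, scaled to have unit diameter. -/
def Lambda {d : ℕ} (x y : S d) : ℝ := Lambda0 (rho x y)

/-- The bilinear form of the kernel `Lambda ^ α`. -/
def bilin {d : ℕ} (α : ℝ) (μ ν : ProbabilityMeasure (S d)) : ℝ :=
  ∫ y, ∫ x, Lambda x y ^ α ∂(μ : Measure (S d)) ∂(ν : Measure (S d))

/-- The energy: half of the quadratic form of the kernel `Lambda ^ α`. -/
def energy {d : ℕ} (α : ℝ) (μ : ProbabilityMeasure (S d)) : ℝ :=
  1 / 2 * bilin α μ μ

/-- The set of maximizers of the energy among all Borel probability measures on the sphere. -/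
def maximizers (d : ℕ) (α : ℝ) : Set (ProbabilityMeasure (S d)) :=
  {μ | ∀ ν : ProbabilityMeasure (S d), energy α ν ≤ energy α μ}

/-- The self-map of the sphere induced by a linear isometry. -/
def sphereMap {d : ℕ} (M : E d ≃ₗᵢ[ℝ] E d) (x : S d) : S d :=
  ⟨M x, by simp⟩

/-- Essential equivalence: the projections to projective space are rotations of each other. -/
def EssEquiv {d : ℕ} (μ ν : ProbabilityMeasure (S d)) : Prop :=
  ∃ M : E d ≃ₗᵢ[ℝ] E d, LinearMap.det (M.toLinearEquiv : E d →ₗ[ℝ] E d) = 1 ∧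
    ∀ A : Set (S d), IsOpen A →
      (μ : Measure (S d)) (A ∪ {x | -x ∈ A}) =
        (ν : Measure (S d)) (sphereMap M '' (A ∪ {x | -x ∈ A}))

/-- Probability measures whose support is an orthonormal basis. -/
def onMeasures (d : ℕ) : Set (ProbabilityMeasure (S d)) :=
  {μ | ∃ v : OrthonormalBasis (Fin (d + 1)) ℝ (E d),
    (fun x : S d => (x : E d)) '' (μ : Measure (S d)).support = Set.range v}

/-- Measures that distribute their mass equally over an orthonormal basis. -/
def onEqMeasures (d : ℕ) : Set (ProbabilityMeasure (S d)) :=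
  {μ | μ ∈ onMeasures d ∧
    ∀ x ∈ (μ : Measure (S d)).support, (μ : Measure (S d)) {x} = ((d : ℝ≥0∞) + 1)⁻¹}

/-- Measures essentially equivalent to equidistribution over an orthonormal basis. -/
def simplexEqMeasures (d : ℕ) : Set (ProbabilityMeasure (S d)) :=
  {μ | ∃ ν ∈ onEqMeasures d, EssEquiv μ ν}

/-- `a ∈ [0, ∞]` is a threshold exponent: for `0 < α < a` no measure equidistributed over a maximal
projective simplex maximizes the energy, for `a < α < ∞` these measures are exactly the
maximizers. -/
def IsThreshold (d : ℕ) (a : ℝ≥0∞) : Prop :=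
  (∀ α : ℝ, 0 < α → ENNReal.ofReal α < a → Disjoint (simplexEqMeasures d) (maximizers d α)) ∧
  (∀ α : ℝ, 0 < α → a < ENNReal.ofReal α → simplexEqMeasures d = maximizers d α)

/-- The joint measures with marginals `μ` and `ν`. -/
def couplings {d : ℕ} (μ ν : ProbabilityMeasure (S d)) : Set (Measure (S d × S d)) :=
  {γ | γ.map Prod.fst = (μ : Measure (S d)) ∧ γ.map Prod.snd = (ν : Measure (S d))}

/-- The optimal transport distance of order infinity. -/
def dInfty {d : ℕ} (μ ν : ProbabilityMeasure (S d)) : ℝ≥0∞ :=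
  ⨅ γ ∈ couplings μ ν, ⨆ p ∈ γ.support, ENNReal.ofReal (rho p.1 p.2)

/-- Continuity at `a` of a curve of measures for the distance `dInfty`. -/
def DInftyContinuousAt {d : ℕ} (μ : ℝ → ProbabilityMeasure (S d)) (a : ℝ) : Prop :=
  Tendsto (fun α => dInfty (μ α) (μ a)) (𝓝 a) (𝓝 0)

end ProjectiveAngle

end

noncomputable section

namespace ProjectiveAngle

section

variable {d : ℕ}

/-! ### The kernel -/

/-! The simplex value of `bilin` is `d / (d + 1)` for every exponent, while `Λ ^ α` decreases in `α`
because `0 ≤ Λ ≤ 1`. So once a simplex measure is optimal, it stays optimal for larger exponents.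
Rigidity (`axisEquidistributed_of_bilin_le`): if `bilin α μ μ ≤ d / (d + 1) ≤ bilin β μ μ` with `α <
β`, then `Λ` is 0 or 1 on the support. The support then lies on the axes of one orthonormal basis,
and equality in the frame inequality `le_integral_inner_sq` makes the axis masses equal. Hence the
threshold is the infimum of the exponents at which a simplex measure is optimal.

The threshold is at most 2 because `Λ ^ 2 ≤ 1 - ⟪x, y⟫ ^ 2` reduces that case to the frame
inequality. It is at least 1 because for `α < 1` the potential of a simplex measure at the midpoint
of two basis vectors exceeds its mean.

The jump comes from local maximality (`bilin_le_of_axisNbhd`): for `α > 1`, moving mass slightly off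
the axes gains less within a block than it loses between blocks, where `Λ` drops linearly from 1. If
a curve of maximizers were continuous at a threshold `t > 1`, its members just below `t` would be
close to a simplex measure. Local maximality at a fixed exponent between 1 and `t`, with rigidity,
would make them simplex measures, which the threshold excludes. -/

lemma inner_mem_Icc (x y : S d) : ⟪(x : E d), (y : E d)⟫ ∈ Set.Icc (-1 : ℝ) 1 := by
  have h := abs_real_inner_le_norm (x : E d) (y : E d)
  simp only [norm_eq_of_mem_sphere, mul_one] at h
  exact abs_le.1 h

lemma abs_inner_le_one (x y : S d) : |⟪(x : E d), (y : E d)⟫| ≤ 1 :=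
  abs_le.2 (inner_mem_Icc x y)

lemma Lambda_eq_arcsin (x y : S d) :
    Lambda x y = 1 - 2 / Real.pi * Real.arcsin |⟪(x : E d), (y : E d)⟫| := by
  unfold Lambda Lambda0 rho
  rw [Real.arccos_eq_pi_div_two_sub_arcsin]
  rcases le_total 0 ⟪(x : E d), (y : E d)⟫ with h | h
  · have h' := Real.arcsin_nonneg.2 h
    rw [abs_of_nonneg h, min_eq_left (by linarith)]
    field_simp
  · have h' := Real.arcsin_nonpos.2 h
    rw [abs_of_nonpos h, min_eq_right (by linarith), Real.arcsin_neg]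
    field_simp
    ring

lemma Lambda_comm (x y : S d) : Lambda x y = Lambda y x := by
  simp [Lambda_eq_arcsin, real_inner_comm]

lemma Lambda_nonneg (x y : S d) : 0 ≤ Lambda x y := by
  rw [Lambda_eq_arcsin, sub_nonneg]
  have h := Real.arcsin_le_pi_div_two |⟪(x : E d), (y : E d)⟫|
  have hp := Real.pi_pos
  calc 2 / Real.pi * Real.arcsin |⟪(x : E d), (y : E d)⟫| ≤ 2 / Real.pi * (Real.pi / 2) := by gcongr
    _ = 1 := by field_simp

lemma Lambda_le_one_sub (x y : S d) :
    Lambda x y ≤ 1 - 2 / Real.pi * |⟪(x : E d), (y : E d)⟫| := by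
  rw [Lambda_eq_arcsin]
  have h : |⟪(x : E d), (y : E d)⟫| ≤ Real.arcsin |⟪(x : E d), (y : E d)⟫| := by
    have h0 := Real.arcsin_nonneg.2 (abs_nonneg ⟪(x : E d), (y : E d)⟫)
    have := Real.sin_le h0
    rwa [Real.sin_arcsin (by linarith [abs_nonneg ⟪(x : E d), (y : E d)⟫])
      (abs_inner_le_one x y)] at this
  have hp := Real.pi_pos
  gcongr

lemma Lambda_le_one (x y : S d) : Lambda x y ≤ 1 := by
  have h := Lambda_le_one_sub x y
  have hp := Real.pi_pos
  have : 0 ≤ 2 / Real.pi * |⟪(x : E d), (y : E d)⟫| := by positivity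
  linarith

/-- The linear drop at orthogonality, from `s ≤ arcsin s` and `π ≤ 4`. It supplies the loss between
blocks in `bilin_le_of_axisNbhd`. -/
lemma Lambda_le_one_sub_half (x y : S d) :
    Lambda x y ≤ 1 - 1 / 2 * |⟪(x : E d), (y : E d)⟫| := by
  refine (Lambda_le_one_sub x y).trans ?_
  have : (1 : ℝ) / 2 ≤ 2 / Real.pi := by
    rw [div_le_div_iff₀ two_pos Real.pi_pos]
    linarith [Real.pi_le_four]
  gcongr

/-- Jordan's inequality `2θ/π ≤ sin θ` on `[0, π/2]`, squared, with `θ` the angle between the lines.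
-/
lemma Lambda_sq_le (x y : S d) : Lambda x y ^ 2 ≤ 1 - ⟪(x : E d), (y : E d)⟫ ^ 2 := by
  set c := |⟪(x : E d), (y : E d)⟫| with hc
  have h0 : 0 ≤ c := abs_nonneg _
  have h1 : c ≤ 1 := abs_inner_le_one x y
  have hL : Lambda x y = 2 / Real.pi * Real.arccos c := by
    rw [Lambda_eq_arcsin, Real.arccos_eq_pi_div_two_sub_arcsin, mul_sub]
    field_simp
    rfl
  have h2 : Lambda x y ≤ Real.sin (Real.arccos c) := by
    rw [hL]
    exact Real.mul_le_sin (Real.arccos_nonneg _) (Real.arccos_le_pi_div_two.2 h0)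
  calc Lambda x y ^ 2 ≤ Real.sin (Real.arccos c) ^ 2 := by
        have := Lambda_nonneg x y
        gcongr
    _ = 1 - c ^ 2 := by
        rw [Real.sin_arccos, Real.sq_sqrt (by nlinarith)]
    _ = 1 - ⟪(x : E d), (y : E d)⟫ ^ 2 := by rw [hc, sq_abs]

lemma norm_sub_sq_sphere (x y : S d) :
    ‖(x : E d) - y‖ ^ 2 = 2 - 2 * ⟪(x : E d), (y : E d)⟫ := by
  rw [norm_sub_sq_real]
  simp only [norm_eq_of_mem_sphere]
  ring

lemma Lambda_le_norm_sub (x y : S d) : Lambda x y ≤ ‖(x : E d) - y‖ := by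
  refine le_of_sq_le_sq ?_ (norm_nonneg _)
  rw [norm_sub_sq_sphere]
  nlinarith [Lambda_sq_le x y, sq_nonneg (⟪(x : E d), (y : E d)⟫ - 1)]

lemma norm_sub_le_rho (x y : S d) : ‖(x : E d) - y‖ ≤ rho x y := by
  refine le_of_sq_le_sq ?_ (Real.arccos_nonneg _)
  rw [norm_sub_sq_sphere]
  have h := Real.one_sub_sq_div_two_le_cos (x := rho x y)
  have h2 : Real.cos (rho x y) = ⟪(x : E d), (y : E d)⟫ :=
    Real.cos_arccos (inner_mem_Icc x y).1 (inner_mem_Icc x y).2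
  linarith

lemma Lambda_neg_left (x y : S d) : Lambda (-x) y = Lambda x y := by
  simp [Lambda_eq_arcsin]

lemma Lambda_neg_right (x y : S d) : Lambda x (-y) = Lambda x y := by
  simp [Lambda_eq_arcsin]

lemma Lambda_eq_one {x y : S d} (h : ⟪(x : E d), (y : E d)⟫ = 0) : Lambda x y = 1 := by
  simp [Lambda_eq_arcsin, h]

lemma Lambda_eq_zero {x y : S d} (h : |⟪(x : E d), (y : E d)⟫| = 1) : Lambda x y = 0 := by
  rw [Lambda_eq_arcsin, h, Real.arcsin_one]
  field_simp
  norm_num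

lemma Lambda_self (x : S d) : Lambda x x = 0 :=
  Lambda_eq_zero (by simp)

lemma inner_eq_zero_of_Lambda_eq_one {x y : S d} (h : Lambda x y = 1) :
    ⟪(x : E d), (y : E d)⟫ = 0 := by
  have := Lambda_sq_le x y
  rw [h] at this
  exact pow_eq_zero_iff two_ne_zero |>.1 (le_antisymm (by linarith) (sq_nonneg _))

lemma abs_inner_eq_one_of_Lambda_eq_zero {x y : S d} (h : Lambda x y = 0) :
    |⟪(x : E d), (y : E d)⟫| = 1 := by
  rw [Lambda_eq_arcsin] at h
  have h2 : Real.arcsin |⟪(x : E d), (y : E d)⟫| = Real.pi / 2 := by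
    have hp := Real.pi_pos
    field_simp at h
    linarith
  exact le_antisymm (abs_inner_le_one x y) (Real.arcsin_eq_pi_div_two.1 h2)

lemma continuous_Lambda : Continuous fun p : S d × S d => Lambda p.1 p.2 := by
  simp only [Lambda_eq_arcsin]
  fun_prop

lemma continuous_Lambda_rpow {α : ℝ} (hα : 0 < α) :
    Continuous fun p : S d × S d => Lambda p.1 p.2 ^ α :=
  continuous_Lambda.rpow_const fun _ => Or.inr hα.le

lemma Lambda_rpow_nonneg (α : ℝ) (x y : S d) : 0 ≤ Lambda x y ^ α :=
  Real.rpow_nonneg (Lambda_nonneg x y) α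

lemma Lambda_rpow_le_one {α : ℝ} (hα : 0 < α) (x y : S d) : Lambda x y ^ α ≤ 1 :=
  Real.rpow_le_one (Lambda_nonneg x y) (Lambda_le_one x y) hα.le

lemma Lambda_rpow_anti {α β : ℝ} (hα : 0 < α) (h : α ≤ β) (x y : S d) :
    Lambda x y ^ β ≤ Lambda x y ^ α :=
  Real.rpow_le_rpow_of_exponent_ge' (Lambda_nonneg x y) (Lambda_le_one x y) hα.le h

lemma Lambda_rpow_eq_one {α : ℝ} {x y : S d} (h : ⟪(x : E d), (y : E d)⟫ = 0) :
    Lambda x y ^ α = 1 := by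
  rw [Lambda_eq_one h, Real.one_rpow]

lemma Lambda_eq_zero_or_one_of_rpow_eq {α β : ℝ} (h : α < β) {x y : S d}
    (he : Lambda x y ^ α = Lambda x y ^ β) : Lambda x y = 0 ∨ Lambda x y = 1 := by
  by_contra! hne
  have h0 := lt_of_le_of_ne (Lambda_nonneg x y) hne.1.symm
  have h1 := lt_of_le_of_ne (Lambda_le_one x y) hne.2
  exact (Real.rpow_lt_rpow_of_exponent_gt h0 h1 h).ne' he

/-! ### Integrals of continuous functions over the sphere -/

lemma integrable_of_continuous (μ : Measure (S d)) [IsFiniteMeasure μ] {f : S d → ℝ}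
    (hf : Continuous f) : Integrable f μ :=
  hf.integrable_of_hasCompactSupport (HasCompactSupport.of_compactSpace f)

lemma integrable_prod_of_continuous (μ ν : Measure (S d)) [IsFiniteMeasure μ] [IsFiniteMeasure ν]
    {f : S d × S d → ℝ} (hf : Continuous f) : Integrable f (μ.prod ν) :=
  hf.integrable_of_hasCompactSupport (HasCompactSupport.of_compactSpace f)

lemma continuous_integral_left (μ : Measure (S d)) [IsFiniteMeasure μ] {f : S d × S d → ℝ}
    (hf : Continuous f) : Continuous fun y => ∫ x, f (x, y) ∂μ := by
  obtain ⟨C, hC⟩ := (isCompact_range hf).isBounded.exists_norm_le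
  refine continuous_of_dominated (bound := fun _ => C) (fun y => ?_) (fun y => ?_)
    (integrable_const C) ?_
  · exact (integrable_of_continuous μ (by fun_prop)).aestronglyMeasurable
  · exact Eventually.of_forall fun x => hC _ ⟨(x, y), rfl⟩
  · exact Eventually.of_forall fun x => by fun_prop

lemma bilin_eq_integral_prod {α : ℝ} (hα : 0 < α) (μ : ProbabilityMeasure (S d)) :
    bilin α μ μ = ∫ p : S d × S d, Lambda p.1 p.2 ^ α ∂((μ : Measure (S d)).prod μ) :=
  (integral_prod_symm _ (integrable_prod_of_continuous _ _ (continuous_Lambda_rpow hα))).symm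

end

section

variable {d : ℕ}

/-! ### Neighbourhoods of the axes of an orthonormal basis -/

/-- The points of the sphere at chordal distance at most `r` from `± b i`. -/
def axisNbhd (b : OrthonormalBasis (Fin (d + 1)) ℝ (E d)) (i : Fin (d + 1)) (r : ℝ) : Set (S d) :=
  {x | ‖(x : E d) - b i‖ ≤ r ∨ ‖(x : E d) + b i‖ ≤ r}

/-- Equidistribution over the axes of an orthonormal basis. -/
def AxisEquidistributed (μ : ProbabilityMeasure (S d)) : Prop :=
  ∃ b : OrthonormalBasis (Fin (d + 1)) ℝ (E d), ∀ i,
    ((d : ℝ≥0∞) + 1)⁻¹ ≤ (μ : Measure (S d)) (axisNbhd b i 0)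

/-- A basis vector as a point of the sphere. -/
def basisPoint (b : OrthonormalBasis (Fin (d + 1)) ℝ (E d)) (i : Fin (d + 1)) : S d :=
  ⟨b i, by simp⟩

variable {b : OrthonormalBasis (Fin (d + 1)) ℝ (E d)}

@[simp] lemma coe_basisPoint (i : Fin (d + 1)) : (basisPoint b i : E d) = b i := rfl

lemma mem_axisNbhd_zero {i : Fin (d + 1)} {x : S d} :
    x ∈ axisNbhd b i 0 ↔ x = basisPoint b i ∨ x = -basisPoint b i := by
  simp only [axisNbhd, Set.mem_ofPred_eq, norm_le_zero_iff, sub_eq_zero, add_eq_zero_iff_eq_neg,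
    Subtype.ext_iff, coe_neg_sphere, coe_basisPoint]

lemma isClosed_axisNbhd (i : Fin (d + 1)) (r : ℝ) : IsClosed (axisNbhd b i r) :=
  (isClosed_le (f := fun x : S d => ‖(x : E d) - b i‖) (by fun_prop) continuous_const).union
    (isClosed_le (f := fun x : S d => ‖(x : E d) + b i‖) (by fun_prop) continuous_const)

lemma measurableSet_axisNbhd (i : Fin (d + 1)) (r : ℝ) : MeasurableSet (axisNbhd b i r) :=
  (isClosed_axisNbhd i r).measurableSet

lemma inner_basis (i j : Fin (d + 1)) : ⟪b i, b j⟫ = if i = j then (1 : ℝ) else 0 :=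
  b.inner_eq_ite i j

lemma abs_inner_le_of_mem_axisNbhd {i j : Fin (d + 1)} {r : ℝ} {x : S d}
    (hx : x ∈ axisNbhd b i r) (hij : i ≠ j) : |⟪(x : E d), b j⟫| ≤ r := by
  rcases hx with h | h
  · refine le_trans ?_ h
    have := abs_real_inner_le_norm ((x : E d) - b i) (b j)
    simpa [inner_sub_left, inner_basis, hij] using this
  · refine le_trans ?_ h
    have := abs_real_inner_le_norm ((x : E d) + b i) (b j)
    simpa [inner_add_left, inner_basis, hij] using this

lemma le_abs_inner_of_mem_axisNbhd {i : Fin (d + 1)} {r : ℝ} {x : S d}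
    (hx : x ∈ axisNbhd b i r) : 1 - r ≤ |⟪(x : E d), b i⟫| := by
  rcases hx with h | h
  · have := (abs_real_inner_le_norm ((x : E d) - b i) (b i)).trans
      (by simpa using h : _ ≤ r)
    simp only [inner_sub_left, inner_basis, if_true] at this
    linarith [le_abs_self ⟪(x : E d), b i⟫, (abs_le.1 this).1]
  · have := (abs_real_inner_le_norm ((x : E d) + b i) (b i)).trans
      (by simpa using h : _ ≤ r)
    simp only [inner_add_left, inner_basis, if_true] at this
    linarith [neg_abs_le ⟪(x : E d), b i⟫, (abs_le.1 this).2]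

lemma disjoint_axisNbhd {i j : Fin (d + 1)} (hij : i ≠ j) {r : ℝ} (hr : r < 1 / 2) :
    Disjoint (axisNbhd b i r) (axisNbhd b j r) := by
  refine Set.disjoint_left.2 fun x hi hj => ?_
  have h1 := abs_inner_le_of_mem_axisNbhd hi hij
  have h2 := le_abs_inner_of_mem_axisNbhd hj
  linarith

variable {μ : ProbabilityMeasure (S d)} {r : ℝ}

lemma toReal_inv_succ (d : ℕ) : (((d : ℝ≥0∞) + 1)⁻¹).toReal = ((d : ℝ) + 1)⁻¹ := by
  rw [ENNReal.toReal_inv, ENNReal.toReal_add (by simp) (by simp)]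
  simp

section Masses

variable (hr : r < 1 / 2)
  (hμ : ∀ i, ((d : ℝ≥0∞) + 1)⁻¹ ≤ (μ : Measure (S d)) (axisNbhd b i r))

include hr hμ

/-- The `d + 1` neighbourhoods are disjoint and the lower bounds already sum to 1, so each is an
equality. -/
lemma measureReal_axisNbhd (i : Fin (d + 1)) :
    (μ : Measure (S d)).real (axisNbhd b i r) = ((d : ℝ) + 1)⁻¹ := by
  have hle : ∀ i ∈ (Finset.univ : Finset (Fin (d + 1))),
      ((d : ℝ) + 1)⁻¹ ≤ (μ : Measure (S d)).real (axisNbhd b i r) := fun i _ => by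
    rw [← toReal_inv_succ]
    exact ENNReal.toReal_mono (measure_ne_top _ _) (hμ i)
  have hsum : ∑ i, (μ : Measure (S d)).real (axisNbhd b i r) ≤
      ∑ _i : Fin (d + 1), ((d : ℝ) + 1)⁻¹ := by
    rw [← measureReal_iUnion_fintype (fun i j hij => disjoint_axisNbhd hij hr)
      fun i => measurableSet_axisNbhd i r]
    refine measureReal_le_one.trans (le_of_eq ?_)
    simp only [Finset.sum_const, Finset.card_univ, Fintype.card_fin, nsmul_eq_mul, Nat.cast_add,
      Nat.cast_one]
    field_simp
  exact ((Finset.sum_eq_sum_iff_of_le hle).1 (le_antisymm (Finset.sum_le_sum hle) hsum) i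
    (Finset.mem_univ i)).symm

lemma measure_compl_iUnion_axisNbhd :
    (μ : Measure (S d)) (⋃ i, axisNbhd b i r)ᶜ = 0 := by
  rw [prob_compl_eq_zero_iff (MeasurableSet.iUnion fun i => measurableSet_axisNbhd i r),
    ← ENNReal.toReal_eq_one_iff]
  change (μ : Measure (S d)).real _ = 1
  rw [measureReal_iUnion_fintype (fun i j hij => disjoint_axisNbhd hij hr)
      fun i => measurableSet_axisNbhd i r]
  simp only [measureReal_axisNbhd hr hμ, Finset.sum_const, Finset.card_univ, Fintype.card_fin,
    nsmul_eq_mul, Nat.cast_add, Nat.cast_one]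
  field_simp

lemma integral_eq_sum_axisNbhd {f : S d → ℝ} (hf : Integrable f (μ : Measure (S d))) :
    ∫ x, f x ∂(μ : Measure (S d)) = ∑ i, ∫ x in axisNbhd b i r, f x ∂(μ : Measure (S d)) := by
  rw [← integral_iUnion_fintype (fun i => measurableSet_axisNbhd i r)
    (fun i j hij => disjoint_axisNbhd hij hr)
    fun i => hf.integrableOn]
  exact (setIntegral_eq_integral_of_ae_compl_eq_zero
    (measure_eq_zero_iff_ae_notMem.1 (measure_compl_iUnion_axisNbhd hr hμ) |>.mono
      fun x hx hx' => absurd hx' (by simpa using hx))).symm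

end Masses

lemma integral_eq_average (hμ : ∀ i, ((d : ℝ≥0∞) + 1)⁻¹ ≤ (μ : Measure (S d)) (axisNbhd b i 0))
    {f : S d → ℝ} (hf : Integrable f (μ : Measure (S d))) (hev : ∀ x, f (-x) = f x) :
    ∫ x, f x ∂(μ : Measure (S d)) = ((d : ℝ) + 1)⁻¹ * ∑ i, f (basisPoint b i) := by
  rw [integral_eq_sum_axisNbhd (by norm_num) hμ hf, Finset.mul_sum]
  refine Finset.sum_congr rfl fun i _ => ?_
  have : ∫ x in axisNbhd b i 0, f x ∂(μ : Measure (S d)) =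
      ∫ _x in axisNbhd b i 0, f (basisPoint b i) ∂(μ : Measure (S d)) := by
    refine setIntegral_congr_fun (measurableSet_axisNbhd i 0) fun x hx => ?_
    rcases mem_axisNbhd_zero.1 hx with rfl | rfl
    · rfl
    · exact hev _
  rw [this, setIntegral_const, measureReal_axisNbhd (by norm_num) hμ, smul_eq_mul]

/-! ### The frame inequality -/

lemma sum_sq_inner_basis (b : OrthonormalBasis (Fin (d + 1)) ℝ (E d)) (x : S d) :
    ∑ k, ⟪(x : E d), b k⟫ ^ 2 = 1 := by
  have := b.sum_sq_inner_left (x : E d)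
  simpa [norm_eq_of_mem_sphere] using this

/-- The double integral is the squared Hilbert–Schmidt norm of the second moment matrix `A`.
Dropping the off-diagonal entries leaves `d + 1` numbers with sum 1, whose squares sum to `1 / (d +
1)` plus the squared deviations from the mean. -/
lemma le_integral_inner_sq (b : OrthonormalBasis (Fin (d + 1)) ℝ (E d))
    (μ : ProbabilityMeasure (S d)) :
    ((d : ℝ) + 1)⁻¹ + ∑ k, (∫ x : S d, ⟪(x : E d), b k⟫ ^ 2 ∂(μ : Measure (S d)) -
      ((d : ℝ) + 1)⁻¹) ^ 2 ≤
    ∫ p : S d × S d, ⟪(p.1 : E d), (p.2 : E d)⟫ ^ 2 ∂((μ : Measure (S d)).prod μ) := by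
  set A : Fin (d + 1) → Fin (d + 1) → ℝ := fun k l =>
    ∫ x : S d, ⟪(x : E d), b k⟫ * ⟪(x : E d), b l⟫ ∂(μ : Measure (S d)) with hA
  have hexp : ∫ p : S d × S d, ⟪(p.1 : E d), (p.2 : E d)⟫ ^ 2 ∂((μ : Measure (S d)).prod μ) =
      ∑ k, ∑ l, A k l ^ 2 := by
    have hpt : ∀ p : S d × S d, ⟪(p.1 : E d), (p.2 : E d)⟫ ^ 2 =
        ∑ k, ∑ l, (⟪(p.1 : E d), b k⟫ * ⟪(p.1 : E d), b l⟫) *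
          (⟪(p.2 : E d), b k⟫ * ⟪(p.2 : E d), b l⟫) := fun p => by
      rw [← b.sum_inner_mul_inner (p.1 : E d) (p.2 : E d), sq, Finset.sum_mul_sum]
      refine Finset.sum_congr rfl fun k _ => Finset.sum_congr rfl fun l _ => ?_
      rw [real_inner_comm (p.2 : E d) (b k), real_inner_comm (p.2 : E d) (b l)]
      ring
    simp_rw [hpt]
    rw [integral_finsetSum _ fun k _ => integrable_prod_of_continuous _ _ (by fun_prop)]
    refine Finset.sum_congr rfl fun k _ => ?_
    rw [integral_finsetSum _ fun l _ => integrable_prod_of_continuous _ _ (by fun_prop)]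
    refine Finset.sum_congr rfl fun l _ => ?_
    rw [integral_prod_mul (fun x : S d => ⟪(x : E d), b k⟫ * ⟪(x : E d), b l⟫)
      (fun x : S d => ⟪(x : E d), b k⟫ * ⟪(x : E d), b l⟫), sq]
  have htr : ∑ k, A k k = 1 := by
    simp only [hA, ← sq]
    rw [← integral_finsetSum _ fun k _ => integrable_of_continuous _ (by fun_prop)]
    simp [sum_sq_inner_basis]
  have hdiag : ∑ k, A k k ^ 2 ≤ ∑ k, ∑ l, A k l ^ 2 :=
    Finset.sum_le_sum fun k _ =>
      Finset.single_le_sum (f := fun l => A k l ^ 2) (fun l _ => sq_nonneg _) (Finset.mem_univ k)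
  rw [hexp]
  refine le_trans (le_of_eq ?_) hdiag
  have hAk : ∀ k, ∫ x : S d, ⟪(x : E d), b k⟫ ^ 2 ∂(μ : Measure (S d)) = A k k := fun k => by
    simp only [hA, sq]
  simp only [hAk, sub_sq, Finset.sum_add_distrib, Finset.sum_sub_distrib, ← Finset.sum_mul,
    ← Finset.mul_sum, htr]
  simp only [Finset.sum_const, Finset.card_univ, Fintype.card_fin, nsmul_eq_mul, Nat.cast_add,
    Nat.cast_one]
  field_simp
  ring

/-! ### Rigidity -/

/-- If `g` were nonzero at `(x, y)`, a product neighbourhood would be null for `μ.prod μ`, so one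
factor would be null, against membership in the support. -/
lemma eq_zero_of_mem_support {μ : Measure (S d)} [IsFiniteMeasure μ] {g : S d × S d → ℝ}
    (hg : Continuous g) (h0 : ∀ p, 0 ≤ g p) (hint : ∫ p, g p ∂(μ.prod μ) ≤ 0) {x y : S d}
    (hx : x ∈ μ.support) (hy : y ∈ μ.support) : g (x, y) = 0 := by
  by_contra hne
  have hae := (integral_eq_zero_iff_of_nonneg h0 (integrable_prod_of_continuous μ μ hg)).1
    (le_antisymm hint (integral_nonneg h0))
  have hnull : (μ.prod μ) {p | g p ≠ 0} = 0 := hae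
  have hU : {p | g p ≠ 0} ∈ 𝓝 (x, y) := (isOpen_ne_fun hg continuous_const).mem_nhds hne
  obtain ⟨U, hU, V, hV, hUV⟩ := mem_nhds_prod_iff.1 hU
  have := measure_mono_null hUV hnull
  rw [Measure.prod_prod, mul_eq_zero] at this
  rcases this with h | h
  · exact ((Measure.mem_support_iff_forall x).1 hx U hU).ne' h
  · exact ((Measure.mem_support_iff_forall y).1 hy V hV).ne' h

lemma eq_or_eq_neg_of_abs_inner_eq_one {x y : S d} (h : |⟪(x : E d), (y : E d)⟫| = 1) :
    (x : E d) = y ∨ (x : E d) = -y := by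
  rcases eq_or_eq_neg_of_abs_eq h with h | h
  · left
    have := norm_sub_sq_sphere x y
    rw [h, mul_one, sub_self] at this
    simpa [sub_eq_zero] using this
  · right
    have := norm_sub_sq_sphere x (-y)
    rw [coe_neg_sphere, inner_neg_right, h] at this
    norm_num at this
    exact eq_neg_of_add_eq_zero_left this

/-- Extend a maximal orthonormal subset of `T` to a basis: a point of `T` that is not `±` a member
would be orthogonal to all of them and could be added. -/
lemma exists_basis_subset_axisNbhd {T : Set (S d)}
    (hT : ∀ x ∈ T, ∀ y ∈ T, ⟪(x : E d), (y : E d)⟫ = 0 ∨ |⟪(x : E d), (y : E d)⟫| = 1) :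
    ∃ b : OrthonormalBasis (Fin (d + 1)) ℝ (E d), ∀ x ∈ T, ∃ i, x ∈ axisNbhd b i 0 := by
  obtain ⟨s, hs⟩ := zorn_subset
    {s : Set (E d) | s ⊆ Subtype.val '' T ∧ Orthonormal ℝ (Subtype.val : s → E d)}
    fun c hc hcc => ⟨⋃₀ c, ⟨Set.sUnion_subset fun s hs => (hc hs).1,
      orthonormal_sUnion_of_directed hcc.directedOn fun s hs => (hc hs).2⟩,
      fun s hs => Set.subset_sUnion_of_mem hs⟩
  obtain ⟨u, b, hub, hb⟩ := hs.prop.2.exists_orthonormalBasis_extension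
  have hcard : Fintype.card u = d + 1 := by
    rw [← Module.finrank_eq_card_basis b.toBasis]
    simp
  refine ⟨b.reindex (Fintype.equivFinOfCardEq hcard), fun x hx => ?_⟩
  have key : ∃ v ∈ s, (x : E d) = v ∨ (x : E d) = -v := by
    by_contra! hne
    have hperp : ∀ v ∈ s, ⟪(x : E d), v⟫ = 0 := fun v hv => by
      obtain ⟨y, hy, rfl⟩ := hs.prop.1 hv
      refine (hT x hx y hy).resolve_right fun h => ?_
      rcases eq_or_eq_neg_of_abs_inner_eq_one h with h | h
      · exact (hne _ hv).1 h
      · exact (hne _ hv).2 h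
    have hins : insert (x : E d) s ∈
        {s : Set (E d) | s ⊆ Subtype.val '' T ∧ Orthonormal ℝ (Subtype.val : s → E d)} := by
      refine ⟨Set.insert_subset ⟨x, hx, rfl⟩ hs.prop.1, orthonormal_subtype_iff_ite.2 ?_⟩
      have horth := orthonormal_subtype_iff_ite.1 hs.prop.2
      have hxx : ⟪(x : E d), (x : E d)⟫ = 1 := by simp
      rintro v (rfl | hv) w (rfl | hw)
      · simp
      · rw [hperp w hw, if_neg (hne w hw).1]
      · rw [real_inner_comm, hperp v hv, if_neg fun h => (hne v hv).1 h.symm]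
      · exact horth v hv w hw
    have hmem := hs.le_of_ge hins (Set.subset_insert _ _) (Set.mem_insert _ _)
    exact (hne _ hmem).1 rfl
  obtain ⟨v, hv, hxv⟩ := key
  refine ⟨Fintype.equivFinOfCardEq hcard ⟨v, hub hv⟩, mem_axisNbhd_zero.2 ?_⟩
  simpa [Subtype.ext_iff, hb] using hxv

/-- On the support `Λ ^ α` equals `1 - ⟪x, y⟫ ^ 2`, so `hB` forces equality in the frame inequality
for the adapted basis. The second moments then all equal `1 / (d + 1)`, and they are the axis
masses. -/
lemma axisEquidistributed_of_Lambda {α : ℝ} (hα : 0 < α) {μ : ProbabilityMeasure (S d)}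
    (hL : ∀ x ∈ (μ : Measure (S d)).support, ∀ y ∈ (μ : Measure (S d)).support,
      Lambda x y = 0 ∨ Lambda x y = 1)
    (hB : d / ((d : ℝ) + 1) ≤ bilin α μ μ) : AxisEquidistributed μ := by
  have hT : ∀ x ∈ (μ : Measure (S d)).support, ∀ y ∈ (μ : Measure (S d)).support,
      ⟪(x : E d), (y : E d)⟫ = 0 ∨ |⟪(x : E d), (y : E d)⟫| = 1 := fun x hx y hy =>
    (hL x hx y hy).symm.imp inner_eq_zero_of_Lambda_eq_one abs_inner_eq_one_of_Lambda_eq_zero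
  obtain ⟨b, hb⟩ := exists_basis_subset_axisNbhd hT
  have hsupp : ∀ᵐ x ∂(μ : Measure (S d)), x ∈ (μ : Measure (S d)).support :=
    Measure.support_mem_ae
  have hbil : bilin α μ μ = 1 -
      ∫ p : S d × S d, ⟪(p.1 : E d), (p.2 : E d)⟫ ^ 2 ∂((μ : Measure (S d)).prod μ) := by
    have hone : (1 : ℝ) = ∫ _p : S d × S d, (1 : ℝ) ∂((μ : Measure (S d)).prod μ) := by simp
    refine Eq.trans ?_ (congrArg (· - _) hone.symm)
    rw [bilin_eq_integral_prod hα]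
    rw [← integral_sub (integrable_const 1)
      (integrable_prod_of_continuous _ _ (by fun_prop))]
    refine integral_congr_ae ?_
    have h1 := Measure.quasiMeasurePreserving_fst
      (μ := (μ : Measure (S d))) (ν := (μ : Measure (S d))) |>.ae hsupp
    have h2 := Measure.quasiMeasurePreserving_snd
      (μ := (μ : Measure (S d))) (ν := (μ : Measure (S d))) |>.ae hsupp
    filter_upwards [h1, h2] with p hp1 hp2
    rcases hT _ hp1 _ hp2 with h | h
    · simp [Lambda_eq_one h, h]
    · rw [Lambda_eq_zero h, Real.zero_rpow hα.ne', ← sq_abs, h]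
      norm_num
  have hframe := le_integral_inner_sq b μ
  have hd1 : (d : ℝ) / (d + 1) = 1 - ((d : ℝ) + 1)⁻¹ := by field_simp; ring
  have hsum : ∑ k, (∫ x : S d, ⟪(x : E d), b k⟫ ^ 2 ∂(μ : Measure (S d)) -
      ((d : ℝ) + 1)⁻¹) ^ 2 ≤ 0 := by linarith
  refine ⟨b, fun k => ?_⟩
  have hk : ∫ x : S d, ⟪(x : E d), b k⟫ ^ 2 ∂(μ : Measure (S d)) = ((d : ℝ) + 1)⁻¹ := by
    have := (Finset.single_le_sum (f := fun k => (∫ x : S d, ⟪(x : E d), b k⟫ ^ 2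
      ∂(μ : Measure (S d)) - ((d : ℝ) + 1)⁻¹) ^ 2) (fun l _ => sq_nonneg _)
      (Finset.mem_univ k)).trans hsum
    have := pow_eq_zero_iff two_ne_zero |>.1 (le_antisymm this (sq_nonneg _))
    linarith
  have hmass : ∫ x : S d, ⟪(x : E d), b k⟫ ^ 2 ∂(μ : Measure (S d)) =
      (μ : Measure (S d)).real (axisNbhd b k 0) := by
    rw [← integral_indicator_one (measurableSet_axisNbhd k 0)]
    refine integral_congr_ae ?_
    filter_upwards [hsupp] with x hx
    obtain ⟨i, hi⟩ := hb x hx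
    by_cases hik : i = k
    · subst hik
      rw [Set.indicator_of_mem hi, Pi.one_apply, ← sq_abs,
        pow_eq_one_iff_of_nonneg (abs_nonneg _) two_ne_zero]
      refine le_antisymm (abs_inner_le_one x (basisPoint b i)) ?_
      simpa using le_abs_inner_of_mem_axisNbhd hi
    · rw [Set.indicator_of_notMem (Set.disjoint_left.1 (disjoint_axisNbhd hik (by norm_num)) hi)]
      have := abs_inner_le_of_mem_axisNbhd hi hik
      simpa using this
  rw [← ENNReal.ofReal_toReal (measure_ne_top (μ : Measure (S d)) (axisNbhd b k 0))]
  change _ ≤ ENNReal.ofReal ((μ : Measure (S d)).real (axisNbhd b k 0))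
  rw [← hmass, hk, ← toReal_inv_succ, ENNReal.ofReal_toReal (by simp)]

lemma axisEquidistributed_of_bilin_le {α β : ℝ} (hα : 0 < α) (hαβ : α < β)
    {μ : ProbabilityMeasure (S d)} (h1 : bilin α μ μ ≤ d / ((d : ℝ) + 1))
    (h2 : d / ((d : ℝ) + 1) ≤ bilin β μ μ) : AxisEquidistributed μ := by
  have hβ := hα.trans hαβ
  refine axisEquidistributed_of_Lambda hβ (fun x hx y hy => ?_) h2
  refine Lambda_eq_zero_or_one_of_rpow_eq hαβ (sub_eq_zero.1 ?_)
  refine eq_zero_of_mem_support (g := fun p => Lambda p.1 p.2 ^ α - Lambda p.1 p.2 ^ β)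
    ((continuous_Lambda_rpow hα).sub (continuous_Lambda_rpow hβ))
    (fun p => sub_nonneg.2 (Lambda_rpow_anti hα hαβ.le _ _)) ?_ hx hy
  rw [integral_sub (integrable_prod_of_continuous _ _ (continuous_Lambda_rpow hα))
    (integrable_prod_of_continuous _ _ (continuous_Lambda_rpow hβ)),
    ← bilin_eq_integral_prod hα, ← bilin_eq_integral_prod hβ]
  linarith

end

section

variable {d : ℕ} {b : OrthonormalBasis (Fin (d + 1)) ℝ (E d)} {μ ν : ProbabilityMeasure (S d)}

/-! ### Measures equidistributed over a maximal simplex -/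

lemma basisPoint_injective (b : OrthonormalBasis (Fin (d + 1)) ℝ (E d)) :
    Function.Injective (basisPoint b) := fun i j h =>
  b.toBasis.injective (by simpa using congrArg Subtype.val h)

lemma measure_eq_of_equidistributed
    (hμ : ∀ i, ((d : ℝ≥0∞) + 1)⁻¹ ≤ (μ : Measure (S d)) (axisNbhd b i 0))
    (hν : ∀ i, ((d : ℝ≥0∞) + 1)⁻¹ ≤ (ν : Measure (S d)) (axisNbhd b i 0))
    {C : Set (S d)} (hC : MeasurableSet C) (hsymm : ∀ x, -x ∈ C ↔ x ∈ C) :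
    (μ : Measure (S d)) C = (ν : Measure (S d)) C := by
  have key : ∀ κ : ProbabilityMeasure (S d),
      (∀ i, ((d : ℝ≥0∞) + 1)⁻¹ ≤ (κ : Measure (S d)) (axisNbhd b i 0)) →
      (κ : Measure (S d)).real C =
        ((d : ℝ) + 1)⁻¹ * ∑ i, C.indicator (1 : S d → ℝ) (basisPoint b i) := fun κ hκ => by
    rw [← integral_indicator_one hC]
    refine integral_eq_average hκ ((integrable_const 1).indicator hC) fun x => ?_
    by_cases hx : x ∈ C
    · rw [Set.indicator_of_mem ((hsymm x).2 hx), Set.indicator_of_mem hx, Pi.one_apply,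
        Pi.one_apply]
    · rw [Set.indicator_of_notMem (mt (hsymm x).1 hx), Set.indicator_of_notMem hx]
  exact (measureReal_eq_measureReal_iff).1 ((key μ hμ).trans (key ν hν).symm)

/-- The uniform measure on an orthonormal basis. -/
def basisMeasure (b : OrthonormalBasis (Fin (d + 1)) ℝ (E d)) : ProbabilityMeasure (S d) :=
  ⟨∑ i, ((d : ℝ≥0∞) + 1)⁻¹ • Measure.dirac (basisPoint b i), ⟨by
    simp only [Measure.coe_finsetSum, Finset.sum_apply, Measure.smul_apply, measure_univ,
      smul_eq_mul, mul_one, Finset.sum_const, Finset.card_univ, Fintype.card_fin, nsmul_eq_mul,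
      Nat.cast_add, Nat.cast_one]
    exact ENNReal.mul_inv_cancel (by simp) (by simp)⟩⟩

lemma basisMeasure_apply {C : Set (S d)} (hC : MeasurableSet C) :
    (basisMeasure b : Measure (S d)) C =
      ∑ i, ((d : ℝ≥0∞) + 1)⁻¹ * C.indicator 1 (basisPoint b i) := by
  change (∑ i, ((d : ℝ≥0∞) + 1)⁻¹ • Measure.dirac (basisPoint b i) : Measure (S d)) C = _
  simp [hC]

lemma basisMeasure_singleton (i : Fin (d + 1)) :
    (basisMeasure b : Measure (S d)) {basisPoint b i} = ((d : ℝ≥0∞) + 1)⁻¹ := by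
  rw [basisMeasure_apply (measurableSet_singleton _)]
  simp [Set.indicator, (basisPoint_injective b).eq_iff]

lemma inv_succ_le_basisMeasure (i : Fin (d + 1)) :
    ((d : ℝ≥0∞) + 1)⁻¹ ≤ (basisMeasure b : Measure (S d)) (axisNbhd b i 0) := by
  rw [← basisMeasure_singleton (b := b) i]
  exact measure_mono (Set.singleton_subset_iff.2 (mem_axisNbhd_zero.2 (Or.inl rfl)))

lemma support_basisMeasure :
    (basisMeasure b : Measure (S d)).support = Set.range (basisPoint b) := by
  refine Set.Subset.antisymm ?_ ?_
  · refine Measure.support_subset_of_isClosed (Set.finite_range _).isClosed ?_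
    rw [mem_ae_iff, basisMeasure_apply (Set.finite_range _).measurableSet.compl]
    simp
  · rintro _ ⟨i, rfl⟩
    refine (Measure.mem_support_iff_forall _).2 fun U hU => ?_
    have h : (basisMeasure b : Measure (S d)) {basisPoint b i} ≤
        (basisMeasure b : Measure (S d)) U :=
      measure_mono (Set.singleton_subset_iff.2 (mem_of_mem_nhds hU))
    rw [basisMeasure_singleton] at h
    exact lt_of_lt_of_le (by simp) h

lemma basisMeasure_mem_onEqMeasures : basisMeasure b ∈ onEqMeasures d := by
  refine ⟨⟨b, ?_⟩, ?_⟩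
  · rw [support_basisMeasure, ← Set.range_comp]
    rfl
  · rw [support_basisMeasure]
    rintro _ ⟨i, rfl⟩
    exact basisMeasure_singleton i

lemma axisEquidistributed_of_mem_simplexEqMeasures (h : μ ∈ simplexEqMeasures d) :
    AxisEquidistributed μ := by
  obtain ⟨ν, ⟨⟨v, hv⟩, hmass⟩, M, -, hM⟩ := h
  refine ⟨v.map M.symm, fun i => ?_⟩
  set C := axisNbhd (v.map M.symm) i 0 with hC
  -- Essential equivalence only tests open sets, so the closed set `C` is reached through its
  -- symmetric open complement.
  have hCc : Cᶜ ∪ {x | -x ∈ Cᶜ} = Cᶜ := by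
    refine Set.union_eq_left.2 fun x hx => ?_
    simp only [Set.mem_ofPred_eq, Set.mem_compl_iff, hC, mem_axisNbhd_zero,
      neg_eq_iff_eq_neg, neg_neg] at hx ⊢
    tauto
  have hMC := hM Cᶜ (isClosed_axisNbhd i 0).isOpen_compl
  rw [hCc] at hMC
  have hvi : basisPoint v i ∈ (ν : Measure (S d)).support := by
    have : (v i : E d) ∈ (fun x : S d => (x : E d)) '' (ν : Measure (S d)).support :=
      hv ▸ Set.mem_range_self i
    obtain ⟨x, hx, hxv⟩ := this
    rwa [show basisPoint v i = x from Subtype.ext hxv.symm]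
  have hsub : sphereMap M '' Cᶜ ⊆ {basisPoint v i}ᶜ := by
    rintro _ ⟨x, hx, rfl⟩ heq
    refine hx (mem_axisNbhd_zero.2 (Or.inl (Subtype.ext ?_)))
    have h2 : M x = v i := congrArg Subtype.val (Set.mem_singleton_iff.1 heq)
    simp [← h2]
  calc ((d : ℝ≥0∞) + 1)⁻¹ = (ν : Measure (S d)) {basisPoint v i} := (hmass _ hvi).symm
    _ = 1 - (ν : Measure (S d)) {basisPoint v i}ᶜ := by
        rw [← prob_compl_eq_one_sub (measurableSet_singleton _).compl, compl_compl]
    _ ≤ 1 - (ν : Measure (S d)) (sphereMap M '' Cᶜ) := tsub_le_tsub_left (measure_mono hsub) _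
    _ = (μ : Measure (S d)) C := by
        rw [← hMC, ← prob_compl_eq_one_sub (measurableSet_axisNbhd i 0).compl, compl_compl]

/-- The rotation can be absorbed into the basis, so the identity serves for the converse. -/
lemma mem_simplexEqMeasures_iff : μ ∈ simplexEqMeasures d ↔ AxisEquidistributed μ := by
  refine ⟨axisEquidistributed_of_mem_simplexEqMeasures, fun ⟨b, hb⟩ => ?_⟩
  refine ⟨basisMeasure b, basisMeasure_mem_onEqMeasures, LinearIsometryEquiv.refl ℝ (E d), ?_,
    fun A hA => ?_⟩
  · exact LinearMap.det_id
  · have hid : sphereMap (LinearIsometryEquiv.refl ℝ (E d)) = id := rfl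
    rw [hid, Set.image_id]
    have hneg : MeasurableSet {x : S d | -x ∈ A} := (hA.preimage continuous_neg).measurableSet
    refine measure_eq_of_equidistributed hb inv_succ_le_basisMeasure (hA.measurableSet.union hneg)
      fun x => ?_
    simp only [Set.mem_union, Set.mem_ofPred_eq, neg_neg]
    exact or_comm

lemma simplexEqMeasures_nonempty (d : ℕ) : (simplexEqMeasures d).Nonempty :=
  ⟨_, mem_simplexEqMeasures_iff.2
    ⟨EuclideanSpace.basisFun (Fin (d + 1)) ℝ, inv_succ_le_basisMeasure⟩⟩

/-! ### Energy of simplex measures -/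

lemma continuous_Lambda_rpow_left {α : ℝ} (hα : 0 < α) (y : S d) :
    Continuous fun x : S d => Lambda x y ^ α :=
  (continuous_Lambda_rpow hα).comp (f := fun x : S d => (x, y)) (by fun_prop)

lemma continuous_potential {α : ℝ} (hα : 0 < α) (μ : ProbabilityMeasure (S d)) :
    Continuous fun y : S d => ∫ x, Lambda x y ^ α ∂(μ : Measure (S d)) :=
  continuous_integral_left (μ : Measure (S d)) (continuous_Lambda_rpow hα)

lemma potential_eq_average {α : ℝ} (hα : 0 < α)
    (hμ : ∀ i, ((d : ℝ≥0∞) + 1)⁻¹ ≤ (μ : Measure (S d)) (axisNbhd b i 0)) (y : S d) :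
    ∫ x, Lambda x y ^ α ∂(μ : Measure (S d)) =
      ((d : ℝ) + 1)⁻¹ * ∑ i, Lambda (basisPoint b i) y ^ α :=
  integral_eq_average hμ (integrable_of_continuous _ (continuous_Lambda_rpow_left hα y))
    fun x => by rw [Lambda_neg_left]

lemma bilin_of_axisEquidistributed {α : ℝ} (hα : 0 < α) (h : AxisEquidistributed μ) :
    bilin α μ μ = d / ((d : ℝ) + 1) := by
  obtain ⟨b, hb⟩ := h
  have hK : ∀ i j, Lambda (basisPoint b i) (basisPoint b j) ^ α = 1 - if i = j then 1 else 0 := by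
    intro i j
    split_ifs with hij
    · rw [hij, Lambda_self, Real.zero_rpow hα.ne', sub_self]
    · rw [Lambda_rpow_eq_one (by simp [hij]), sub_zero]
  rw [bilin, integral_eq_average hb (integrable_of_continuous _ (continuous_potential hα μ))
    fun y => by simp only [Lambda_neg_right]]
  simp only [potential_eq_average hα hb, hK, Finset.sum_sub_distrib, Finset.sum_ite_eq',
    Finset.mem_univ, if_true, Finset.sum_const, Finset.card_univ, Fintype.card_fin, nsmul_eq_mul,
    Nat.cast_add, Nat.cast_one]
  field_simp
  ring

lemma bilin_two_le (μ : ProbabilityMeasure (S d)) : bilin 2 μ μ ≤ d / ((d : ℝ) + 1) := by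
  have hframe := le_integral_inner_sq (EuclideanSpace.basisFun (Fin (d + 1)) ℝ) μ
  have hpos := Finset.sum_nonneg fun k (_ : k ∈ Finset.univ) =>
    sq_nonneg (∫ x : S d, ⟪(x : E d), EuclideanSpace.basisFun (Fin (d + 1)) ℝ k⟫ ^ 2
      ∂(μ : Measure (S d)) - ((d : ℝ) + 1)⁻¹)
  have hd1 : (d : ℝ) / (d + 1) = 1 - ((d : ℝ) + 1)⁻¹ := by field_simp; ring
  have hle : bilin 2 μ μ ≤ ∫ p : S d × S d, (1 - ⟪(p.1 : E d), (p.2 : E d)⟫ ^ 2)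
      ∂((μ : Measure (S d)).prod μ) := by
    rw [bilin_eq_integral_prod two_pos]
    refine integral_mono (integrable_prod_of_continuous _ _ (continuous_Lambda_rpow two_pos))
      (integrable_prod_of_continuous _ _ (by fun_prop)) fun p => ?_
    simpa only [Real.rpow_two] using Lambda_sq_le p.1 p.2
  rw [integral_sub (integrable_const 1) (integrable_prod_of_continuous _ _ (by fun_prop))] at hle
  simp only [integral_const, probReal_univ, smul_eq_mul, mul_one] at hle
  linarith

lemma mem_maximizers_iff {α : ℝ} :
    μ ∈ maximizers d α ↔ ∀ ν : ProbabilityMeasure (S d), bilin α ν ν ≤ bilin α μ μ := by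
  simp only [maximizers, energy, Set.mem_ofPred_eq]
  exact forall_congr' fun ν => by constructor <;> intro h <;> linarith

/-! ### Simplex measures do not maximize for exponents below one -/

/-- The convex combination of a probability measure with a point mass. -/
def mixDirac (μ : ProbabilityMeasure (S d)) (p : S d) (s : ℝ) (hs : 0 ≤ s) (hs1 : s ≤ 1) :
    ProbabilityMeasure (S d) :=
  ⟨ENNReal.ofReal (1 - s) • (μ : Measure (S d)) + ENNReal.ofReal s • Measure.dirac p, ⟨by
    simp only [Measure.coe_add, Pi.add_apply, Measure.smul_apply, measure_univ, smul_eq_mul,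
      mul_one]
    rw [← ENNReal.ofReal_add (by linarith) hs, sub_add_cancel, ENNReal.ofReal_one]⟩⟩

lemma integral_mixDirac (p : S d) {s : ℝ} (hs : 0 ≤ s) (hs1 : s ≤ 1) {f : S d → ℝ}
    (hf : Continuous f) :
    ∫ x, f x ∂(mixDirac μ p s hs hs1 : Measure (S d)) =
      (1 - s) * ∫ x, f x ∂(μ : Measure (S d)) + s * f p := by
  change ∫ x, f x ∂(ENNReal.ofReal (1 - s) • (μ : Measure (S d)) +
    ENNReal.ofReal s • Measure.dirac p) = _
  rw [integral_add_measure ((integrable_of_continuous _ hf).smul_measure (by simp))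
    ((integrable_of_continuous _ hf).smul_measure (by simp)), integral_smul_measure,
    integral_smul_measure, integral_dirac, ENNReal.toReal_ofReal (by linarith),
    ENNReal.toReal_ofReal hs]
  simp

lemma bilin_mixDirac {α : ℝ} (hα : 0 < α) (p : S d) {s : ℝ} (hs : 0 ≤ s) (hs1 : s ≤ 1) :
    bilin α (mixDirac μ p s hs hs1) (mixDirac μ p s hs hs1) =
      (1 - s) ^ 2 * bilin α μ μ +
        2 * s * (1 - s) * ∫ x, Lambda x p ^ α ∂(μ : Measure (S d)) := by
  have hin : ∀ y, ∫ x, Lambda x y ^ α ∂(mixDirac μ p s hs hs1 : Measure (S d)) =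
      (1 - s) * ∫ x, Lambda x y ^ α ∂(μ : Measure (S d)) + s * Lambda y p ^ α := fun y => by
    rw [integral_mixDirac p hs hs1 (continuous_Lambda_rpow_left hα y), Lambda_comm p y]
  have hc1 := continuous_potential hα μ
  have hc2 := continuous_Lambda_rpow_left hα p
  rw [bilin]
  simp only [hin]
  have hc3 : Continuous fun y => (1 - s) * ∫ x, Lambda x y ^ α ∂(μ : Measure (S d)) +
      s * Lambda y p ^ α := (hc1.const_mul _).add (hc2.const_mul _)
  rw [integral_mixDirac p hs hs1 hc3,
    integral_add ((integrable_of_continuous _ hc1).const_mul _)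
      ((integrable_of_continuous _ hc2).const_mul _), integral_const_mul, integral_const_mul,
    Lambda_self, Real.zero_rpow hα.ne', ← bilin]
  ring

/-- The first-order optimality condition, obtained by moving a little mass to `p`. -/
lemma potential_le_bilin_of_mem_maximizers {α : ℝ} (hα : 0 < α) (hμ : μ ∈ maximizers d α)
    (p : S d) : ∫ x, Lambda x p ^ α ∂(μ : Measure (S d)) ≤ bilin α μ μ := by
  set U := ∫ x, Lambda x p ^ α ∂(μ : Measure (S d)) with hU
  set B := bilin α μ μ with hB
  by_contra! hlt
  have hB0 : 0 ≤ B := integral_nonneg fun y => integral_nonneg fun x => Lambda_rpow_nonneg α x y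
  have hU1 : U ≤ 1 := by
    have h := integral_mono (μ := (μ : Measure (S d)))
      (integrable_of_continuous _ (continuous_Lambda_rpow_left hα p)) (integrable_const (1 : ℝ))
      fun x => Lambda_rpow_le_one hα x p
    simpa using h
  -- Mixing in mass `s` changes the value by `s * (2 * (U - B) - s * (2 * U - B))`. The choice `s =
  -- (U - B) / 2` makes this positive, since `U ≤ 1` and `0 ≤ B`.
  have h := mem_maximizers_iff.1 hμ (mixDirac μ p ((U - B) / 2) (by linarith) (by linarith))
  rw [bilin_mixDirac hα, ← hU, ← hB] at h
  have h2 : 0 < (U - B) * ((U - B) - (U - B) / 2 * (U - B / 2)) := by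
    refine mul_pos (by linarith) ?_
    nlinarith
  nlinarith

/-- The midpoint `p` of `b 0` and `b k` has `Λ = 1/2` to these two axes and 1 to the others. Its
potential `(d - 1 + 2 * (1/2) ^ α) / (d + 1)` exceeds `d / (d + 1)` when `α < 1`. -/
lemma notMem_maximizers_of_lt_one (hd : 1 ≤ d) {α : ℝ} (hα : 0 < α) (hα1 : α < 1)
    (h : AxisEquidistributed μ) : μ ∉ maximizers d α := by
  intro hmax
  have hB := bilin_of_axisEquidistributed hα h
  obtain ⟨b, hb⟩ := h
  obtain ⟨k, hk⟩ : ∃ k : Fin (d + 1), k ≠ 0 := ⟨⟨1, by omega⟩, by simp [Fin.ext_iff]⟩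
  have hnorm : ‖(√2)⁻¹ • (b 0 + b k)‖ = 1 := by
    have h1 : ‖b 0 + b k‖ ^ 2 = 2 := by
      rw [norm_add_sq_real, inner_basis, if_neg hk.symm]
      simp
      norm_num
    have h2 : ‖b 0 + b k‖ = √2 := by rw [← h1, Real.sqrt_sq (norm_nonneg _)]
    rw [norm_smul, h2, norm_inv, Real.norm_of_nonneg (Real.sqrt_nonneg 2)]
    exact inv_mul_cancel₀ (by positivity)
  set p : S d := ⟨(√2)⁻¹ • (b 0 + b k), by simpa using hnorm⟩ with hp
  have hinner : ∀ i, ⟪b i, (p : E d)⟫ =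
      (√2)⁻¹ * ((if i = 0 then 1 else 0) + if i = k then 1 else 0) := fun i => by
    rw [hp, inner_smul_right, inner_add_right, inner_basis, inner_basis]
  have hhalf : 1 - 2 / Real.pi * Real.arcsin (√2)⁻¹ = 1 / 2 := by
    have : (√2)⁻¹ = Real.sin (Real.pi / 4) := by
      rw [Real.sin_pi_div_four]
      field_simp
      norm_num
    have hpi := Real.pi_pos
    rw [this, Real.arcsin_sin (by linarith) (by linarith)]
    field_simp
    norm_num
  have hK : ∀ i, Lambda (basisPoint b i) p ^ α =
      1 - ((if i = 0 then 1 else 0) + if i = k then 1 else 0) * (1 - (1 / 2 : ℝ) ^ α) := by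
    intro i
    rw [Lambda_eq_arcsin, coe_basisPoint, hinner]
    have habs : |(√2)⁻¹| = (√2)⁻¹ := abs_of_pos (by positivity)
    by_cases hi0 : i = 0
    · simp only [hi0, hk.symm, if_true, if_false, add_zero, mul_one, habs, hhalf]
      ring
    · by_cases hik : i = k
      · simp only [hik, hk, if_true, if_false, zero_add, mul_one, habs, hhalf]
        ring
      · simp [hi0, hik]
  have hle := potential_le_bilin_of_mem_maximizers hα hmax p
  rw [potential_eq_average hα hb, hB] at hle
  simp only [hK, Finset.sum_sub_distrib, ← Finset.sum_mul, Finset.sum_add_distrib,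
    Finset.sum_ite_eq', Finset.mem_univ, if_true, Finset.sum_const, Finset.card_univ,
    Fintype.card_fin, nsmul_eq_mul, Nat.cast_add, Nat.cast_one] at hle
  have hgt : (1 / 2 : ℝ) < (1 / 2 : ℝ) ^ α := by
    simpa using Real.rpow_lt_rpow_of_exponent_gt (by norm_num : (0 : ℝ) < 1 / 2) (by norm_num) hα1
  field_simp at hle hgt
  linarith

end

section

variable {d : ℕ} {b : OrthonormalBasis (Fin (d + 1)) ℝ (E d)} {μ ν : ProbabilityMeasure (S d)}
  {r : ℝ}

/-! ### Local maximality of simplex measures for exponents above one -/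

lemma exists_sign {i : Fin (d + 1)} {x : S d} (hx : x ∈ axisNbhd b i r) :
    ∃ z : S d, ‖(z : E d) - b i‖ ≤ r ∧ (∀ v : E d, |⟪(z : E d), v⟫| = |⟪(x : E d), v⟫|) ∧
      ∀ y, Lambda z y = Lambda x y := by
  rcases hx with h | h
  · exact ⟨x, h, fun _ => rfl, fun _ => rfl⟩
  · refine ⟨-x, ?_, fun v => by simp, Lambda_neg_left x⟩
    rwa [coe_neg_sphere, ← norm_neg, show -(-(x : E d) - b i) = x + b i by abel]

lemma norm_le_sum_abs_inner (b : OrthonormalBasis (Fin (d + 1)) ℝ (E d)) (w : E d) :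
    ‖w‖ ≤ ∑ k, |⟪w, b k⟫| := by
  conv_lhs => rw [← b.sum_repr' w]
  refine (norm_sum_le _ _).trans (le_of_eq (Finset.sum_congr rfl fun k _ => ?_))
  rw [norm_smul, b.norm_eq_one, mul_one, Real.norm_eq_abs, real_inner_comm]

/-- Two points near the same axis can be far apart only if one is visibly non-orthogonal to points
near the other axes. Replacing each `b k` by a nearby point, up to sign, costs `r * ‖w‖`; the total
error is at most `‖w‖ / 2` and is absorbed. -/
lemma norm_sub_le_sum_abs_inner (hr : ((d : ℝ) + 1) * r ≤ 1 / 2) {i : Fin (d + 1)} {x x' : S d}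
    (hx : ‖(x : E d) - b i‖ ≤ r) (hx' : ‖(x' : E d) - b i‖ ≤ r) {y : Fin (d + 1) → S d}
    (hy : ∀ j, y j ∈ axisNbhd b j r) :
    ‖(x : E d) - x'‖ ≤ 2 * ∑ j ∈ Finset.univ.erase i,
      (|⟪(x : E d), (y j : E d)⟫| + |⟪(x' : E d), (y j : E d)⟫|) := by
  choose z hz hzi _ using fun j => exists_sign (hy j)
  set w : E d := (x : E d) - x' with hw
  have hother : ∀ k, |⟪w, b k⟫| ≤
      |⟪(x : E d), (y k : E d)⟫| + |⟪(x' : E d), (y k : E d)⟫| + r * ‖w‖ := fun k => by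
    have h1 : ⟪w, b k⟫ = ⟪(x : E d), (z k : E d)⟫ - ⟪(x' : E d), (z k : E d)⟫ -
        ⟪w, (z k : E d) - b k⟫ := by
      rw [hw]
      simp only [inner_sub_left, inner_sub_right]
      ring
    have h2 : |⟪w, (z k : E d) - b k⟫| ≤ r * ‖w‖ := by
      refine (abs_real_inner_le_norm _ _).trans ?_
      rw [mul_comm]
      exact mul_le_mul_of_nonneg_right (hz k) (norm_nonneg w)
    have h3 : ∀ u : S d, |⟪(u : E d), (z k : E d)⟫| = |⟪(u : E d), (y k : E d)⟫| := fun u => by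
      rw [real_inner_comm, hzi k, real_inner_comm]
    rw [h1, ← h3 x, ← h3 x']
    refine (abs_sub _ _).trans ?_
    gcongr
    exact abs_sub _ _
  have hself : |⟪w, b i⟫| ≤ r * ‖w‖ := by
    -- As `x` and `x'` have equal norm, `w` is orthogonal to their sum, which is nearly `2 • b i`.
    have h0 : ⟪w, (x : E d) + x'⟫ = 0 := by
      rw [hw, inner_sub_left, inner_add_right, inner_add_right, real_inner_self_eq_norm_sq,
        real_inner_self_eq_norm_sq, real_inner_comm (x : E d) (x' : E d)]
      simp only [norm_eq_of_mem_sphere]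
      ring
    have h1 : ⟪w, b i⟫ = -(1 / 2) * (⟪w, (x : E d) - b i⟫ + ⟪w, (x' : E d) - b i⟫) := by
      rw [inner_add_right] at h0
      rw [inner_sub_right, inner_sub_right]
      linarith
    have h2 : ∀ u : S d, ‖(u : E d) - b i‖ ≤ r → |⟪w, (u : E d) - b i⟫| ≤ r * ‖w‖ := fun u hu => by
      refine (abs_real_inner_le_norm _ _).trans ?_
      rw [mul_comm]
      exact mul_le_mul_of_nonneg_right hu (norm_nonneg w)
    have h3 := abs_le.1 (h2 x hx)
    have h4 := abs_le.1 (h2 x' hx')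
    rw [h1, abs_le]
    constructor <;> linarith
  set T := ∑ j ∈ Finset.univ.erase i,
      (|⟪(x : E d), (y j : E d)⟫| + |⟪(x' : E d), (y j : E d)⟫|) with hT
  have hsum : ∑ k, |⟪w, b k⟫| ≤ T + (d + 1) * (r * ‖w‖) := by
    rw [← Finset.add_sum_erase _ _ (Finset.mem_univ i)]
    have h := Finset.sum_le_sum fun k (_ : k ∈ Finset.univ.erase i) => hother k
    rw [Finset.sum_add_distrib, ← hT, Finset.sum_const,
      Finset.card_erase_of_mem (Finset.mem_univ i),
      Finset.card_univ, Fintype.card_fin, Nat.add_sub_cancel, nsmul_eq_mul] at h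
    linarith
  have := norm_le_sum_abs_inner b w
  nlinarith [norm_nonneg w]

/-- One factor `Λ` is bounded by the chord; the remaining `Λ ^ (α - 1)` is small because `α > 1`.
The constant is `2 * (1/8)`. -/
lemma Lambda_rpow_le_sum {α : ℝ} (hα : 1 < α) (hr : ((d : ℝ) + 1) * r ≤ 1 / 2)
    (hr8 : (2 * r) ^ (α - 1) ≤ 1 / 8) {i : Fin (d + 1)} {x x' : S d}
    (hx : x ∈ axisNbhd b i r) (hx' : x' ∈ axisNbhd b i r) {y : Fin (d + 1) → S d}
    (hy : ∀ j, y j ∈ axisNbhd b j r) :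
    Lambda x x' ^ α ≤ 1 / 4 * ∑ j ∈ Finset.univ.erase i,
      (|⟪(x : E d), (y j : E d)⟫| + |⟪(x' : E d), (y j : E d)⟫|) := by
  obtain ⟨z, hz, hzi, hzL⟩ := exists_sign hx
  obtain ⟨z', hz', hzi', hzL'⟩ := exists_sign hx'
  have hL : Lambda x x' = Lambda z z' := by rw [hzL, Lambda_comm x z', hzL', Lambda_comm]
  have hnorm := norm_sub_le_sum_abs_inner hr hz hz' hy
  simp only [hzi, hzi'] at hnorm
  have hdist : ‖(z : E d) - z'‖ ≤ 2 * r := by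
    calc ‖(z : E d) - z'‖ = ‖((z : E d) - b i) - (z' - b i)‖ := by congr 1; abel
      _ ≤ ‖(z : E d) - b i‖ + ‖(z' : E d) - b i‖ := norm_sub_le _ _
      _ ≤ 2 * r := by linarith
  have hle := Lambda_le_norm_sub z z'
  have h0 := Lambda_nonneg z z'
  have hsmall : Lambda z z' ^ (α - 1) ≤ 1 / 8 :=
    (Real.rpow_le_rpow h0 (hle.trans hdist) (by linarith)).trans hr8
  calc Lambda x x' ^ α = Lambda z z' * Lambda z z' ^ (α - 1) := by
        rw [hL, ← Real.rpow_one_add' h0 (by linarith)]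
        congr 1
        ring
    _ ≤ ‖(z : E d) - z'‖ * (1 / 8) := by gcongr
    _ ≤ _ := by linarith

lemma continuous_setIntegral_abs_inner (μ : ProbabilityMeasure (S d)) (B : Set (S d)) :
    Continuous fun x : S d => ∫ y in B, |⟪(x : E d), (y : E d)⟫| ∂(μ : Measure (S d)) :=
  continuous_integral_left ((μ : Measure (S d)).restrict B)
    (f := fun p : S d × S d => |⟪(p.2 : E d), (p.1 : E d)⟫|) (by fun_prop)

/-- For each ordered pair `i ≠ j`, the bound on the gain inside block `i` is `1/2 * I i j`, exactly
the bound on the loss between blocks `i` and `j`. What is left is `m ^ 2` per pair, the simplex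
value. -/
lemma bilin_le_of_axisNbhd {α : ℝ} (hα : 1 < α) (hr : ((d : ℝ) + 1) * r ≤ 1 / 2) (hr2 : r < 1 / 2)
    (hr8 : (2 * r) ^ (α - 1) ≤ 1 / 8)
    (hμ : ∀ i, ((d : ℝ≥0∞) + 1)⁻¹ ≤ (μ : Measure (S d)) (axisNbhd b i r)) :
    bilin α μ μ ≤ d / ((d : ℝ) + 1) := by
  have hα0 : 0 < α := by linarith
  set m : ℝ := ((d : ℝ) + 1)⁻¹ with hm
  have hm0 : 0 < m := by positivity
  have hmass : ∀ i, (μ : Measure (S d)).real (axisNbhd b i r) = m := measureReal_axisNbhd hr2 hμ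
  have hne : ∀ i, (μ : Measure (S d)) (axisNbhd b i r) ≠ 0 := fun i h0 => by
    have := hμ i
    rw [h0, nonpos_iff_eq_zero] at this
    simp at this
  have hint : ∀ (i : Fin (d + 1)) {f : S d → ℝ}, Continuous f →
      IntegrableOn f (axisNbhd b i r) (μ : Measure (S d)) := fun i f hf =>
    (integrable_of_continuous _ hf).integrableOn
  set F : Fin (d + 1) → S d → ℝ := fun j x =>
    ∫ y in axisNbhd b j r, |⟪(x : E d), (y : E d)⟫| ∂(μ : Measure (S d)) with hF
  have hFc : ∀ j, Continuous (F j) := fun j => continuous_setIntegral_abs_inner μ _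
  set I : Fin (d + 1) → Fin (d + 1) → ℝ := fun i j =>
    ∫ x in axisNbhd b i r, F j x ∂(μ : Measure (S d)) with hI
  have hself : ∀ i, ∀ x ∈ axisNbhd b i r, ∀ x' ∈ axisNbhd b i r,
      Lambda x x' ^ α ≤ ∑ j ∈ Finset.univ.erase i, 1 / 4 * m⁻¹ * (F j x + F j x') := by
    intro i x hx x' hx'
    have hc : ∀ u : S d, Continuous fun y : S d => |⟪(u : E d), (y : E d)⟫| := fun u => by fun_prop
    -- In each block some `y j` does no worse than the average, which turns the pointwise bound into
    -- one by `F j`.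
    choose y hy hyle using fun j => exists_le_setAverage (hne j) (measure_ne_top _ _)
      (hint j ((hc x).add (hc x')))
    refine (Lambda_rpow_le_sum hα hr hr8 hx hx' hy).trans ?_
    rw [Finset.mul_sum]
    refine Finset.sum_le_sum fun j _ => ?_
    have h := hyle j
    rw [setAverage_eq, hmass, smul_eq_mul] at h
    simp only [Pi.add_apply] at h
    rw [integral_add (hint j (hc x)) (hint j (hc x'))] at h
    rw [mul_assoc]
    exact mul_le_mul_of_nonneg_left h (by norm_num)
  have hcross : ∀ (j : Fin (d + 1)) (y : S d),
      ∫ x in axisNbhd b j r, Lambda x y ^ α ∂(μ : Measure (S d)) ≤ m - 1 / 2 * F j y := by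
    intro j y
    have hc : Continuous fun x : S d => 1 / 2 * |⟪(y : E d), (x : E d)⟫| := by fun_prop
    have hright : m - 1 / 2 * F j y =
        ∫ x in axisNbhd b j r, (1 - 1 / 2 * |⟪(y : E d), (x : E d)⟫|) ∂(μ : Measure (S d)) := by
      rw [integral_sub (integrable_const 1) (hint j hc), setIntegral_const, hmass,
        integral_const_mul, smul_eq_mul, mul_one]
    rw [hright]
    refine setIntegral_mono (hint j (continuous_Lambda_rpow_left hα0 y))
      (hint j (continuous_const.sub hc)) fun x => ?_
    have h1 := Lambda_rpow_anti one_pos hα.le x y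
    rw [Real.rpow_one] at h1
    refine h1.trans ?_
    rw [real_inner_comm (x : E d) (y : E d)]
    exact Lambda_le_one_sub_half x y
  have hrow : ∀ i, ∀ y ∈ axisNbhd b i r, ∫ x, Lambda x y ^ α ∂(μ : Measure (S d)) ≤
      ∑ j ∈ Finset.univ.erase i, (m + 1 / 4 * m⁻¹ * I i j - 1 / 4 * F j y) := by
    intro i y hy
    have hdiag : ∫ x in axisNbhd b i r, Lambda x y ^ α ∂(μ : Measure (S d)) ≤
        ∑ j ∈ Finset.univ.erase i, 1 / 4 * m⁻¹ * (I i j + m * F j y) := by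
      have hcj : ∀ j, Continuous fun x => 1 / 4 * m⁻¹ * (F j x + F j y) := fun j =>
        ((hFc j).add continuous_const).const_mul _
      refine (setIntegral_mono_on (hint i (continuous_Lambda_rpow_left hα0 y))
        (hint i (continuous_finsetSum _ fun j _ => hcj j)) (measurableSet_axisNbhd i r)
        fun x hx => hself i x hx y hy).trans (le_of_eq ?_)
      rw [integral_finsetSum _ fun j _ => hint i (hcj j)]
      refine Finset.sum_congr rfl fun j _ => ?_
      rw [integral_const_mul, integral_add (hint i (hFc j)) (integrable_const _),
        setIntegral_const, hmass, smul_eq_mul]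
    rw [integral_eq_sum_axisNbhd hr2 hμ
      (integrable_of_continuous _ (continuous_Lambda_rpow_left hα0 y)),
      ← Finset.add_sum_erase _ _ (Finset.mem_univ i)]
    refine (add_le_add hdiag (Finset.sum_le_sum fun j _ => hcross j y)).trans (le_of_eq ?_)
    rw [← Finset.sum_add_distrib]
    refine Finset.sum_congr rfl fun j _ => ?_
    field_simp
    ring
  have hblock : ∀ i, ∫ y in axisNbhd b i r, (∫ x, Lambda x y ^ α ∂(μ : Measure (S d)))
      ∂(μ : Measure (S d)) ≤ d * m ^ 2 := by
    intro i
    have hcj : ∀ j, Continuous fun y => m + 1 / 4 * m⁻¹ * I i j - 1 / 4 * F j y := fun j =>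
      continuous_const.sub ((hFc j).const_mul _)
    refine (setIntegral_mono_on (hint i (continuous_potential hα0 μ))
      (hint i (continuous_finsetSum _ fun j _ => hcj j)) (measurableSet_axisNbhd i r)
      fun y hy => hrow i y hy).trans (le_of_eq ?_)
    rw [integral_finsetSum _ fun j _ => hint i (hcj j)]
    have hj : ∀ j, ∫ y in axisNbhd b i r, (m + 1 / 4 * m⁻¹ * I i j - 1 / 4 * F j y)
        ∂(μ : Measure (S d)) = m ^ 2 := fun j => by
      rw [integral_sub (integrable_const _) (hint i ((hFc j).const_mul _)), setIntegral_const,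
        hmass, smul_eq_mul, integral_const_mul]
      change m * (m + 1 / 4 * m⁻¹ * I i j) - 1 / 4 * I i j = m ^ 2
      field_simp
      ring
    simp only [hj, Finset.sum_const, Finset.card_erase_of_mem (Finset.mem_univ i),
      Finset.card_univ, Fintype.card_fin, Nat.add_sub_cancel, nsmul_eq_mul]
  rw [bilin, integral_eq_sum_axisNbhd hr2 hμ
    (integrable_of_continuous _ (continuous_potential hα0 μ))]
  refine (Finset.sum_le_sum fun i _ => hblock i).trans (le_of_eq ?_)
  simp only [Finset.sum_const, Finset.card_univ, Fintype.card_fin, nsmul_eq_mul, Nat.cast_add,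
    Nat.cast_one, hm]
  field_simp

/-! ### The transport distance of order infinity -/

lemma exists_coupling_ae_lt {s : ℝ} (h : dInfty μ ν < ENNReal.ofReal s) :
    ∃ γ ∈ couplings μ ν, ∀ᵐ p ∂γ, rho p.1 p.2 < s := by
  simp only [dInfty, iInf_lt_iff] at h
  obtain ⟨γ, hγ, hlt⟩ := h
  refine ⟨γ, hγ, ?_⟩
  filter_upwards [Measure.support_mem_ae (μ := γ)] with p hp
  have hp' : ENNReal.ofReal (rho p.1 p.2) < ENNReal.ofReal s :=
    (le_iSup₂ (f := fun (p : S d × S d) (_ : p ∈ γ.support) => ENNReal.ofReal (rho p.1 p.2))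
      p hp).trans_lt hlt
  exact (ENNReal.ofReal_lt_ofReal_iff_of_nonneg (Real.arccos_nonneg _)).1 hp'

lemma measure_le_of_dInfty_lt {s : ℝ} (h : dInfty μ ν < ENNReal.ofReal s) {A B : Set (S d)}
    (hA : MeasurableSet A) (hB : MeasurableSet B)
    (hAB : ∀ x y : S d, ‖(x : E d) - y‖ ≤ s → x ∈ A → y ∈ B) :
    (μ : Measure (S d)) A ≤ (ν : Measure (S d)) B := by
  obtain ⟨γ, ⟨h1, h2⟩, hγ⟩ := exists_coupling_ae_lt h
  rw [← h1, ← h2, Measure.map_apply measurable_fst hA, Measure.map_apply measurable_snd hB]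
  refine measure_mono_ae ?_
  filter_upwards [hγ] with p hp hpA
  exact hAB p.1 p.2 ((norm_sub_le_rho _ _).trans hp.le) hpA

lemma measure_le_of_dInfty_lt' {s : ℝ} (h : dInfty μ ν < ENNReal.ofReal s) {A B : Set (S d)}
    (hA : MeasurableSet A) (hB : MeasurableSet B)
    (hAB : ∀ x y : S d, ‖(x : E d) - y‖ ≤ s → x ∈ A → y ∈ B) :
    (ν : Measure (S d)) A ≤ (μ : Measure (S d)) B := by
  obtain ⟨γ, ⟨h1, h2⟩, hγ⟩ := exists_coupling_ae_lt h
  rw [← h1, ← h2, Measure.map_apply measurable_snd hA, Measure.map_apply measurable_fst hB]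
  refine measure_mono_ae ?_
  filter_upwards [hγ] with p hp hpA
  refine hAB p.2 p.1 ?_ hpA
  rw [norm_sub_rev]
  exact (norm_sub_le_rho _ _).trans hp.le

lemma mem_axisNbhd_add {i : Fin (d + 1)} {s : ℝ} {x y : S d} (h : ‖(x : E d) - y‖ ≤ s)
    (hx : x ∈ axisNbhd b i r) : y ∈ axisNbhd b i (r + s) := by
  rw [norm_sub_rev] at h
  refine hx.imp (fun hx => ?_) fun hx => ?_
  · calc ‖(y : E d) - b i‖ = ‖((x : E d) - b i) + (y - x)‖ := by congr 1; abel
      _ ≤ r + s := (norm_add_le _ _).trans (add_le_add hx h)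
  · calc ‖(y : E d) + b i‖ = ‖((x : E d) + b i) + (y - x)‖ := by congr 1; abel
      _ ≤ r + s := (norm_add_le _ _).trans (add_le_add hx h)

/-! ### The threshold exponent -/

/-- The upper bound passes from `α` to `β` by monotonicity; rigidity then identifies all cases of
equality. -/
lemma simplexEqMeasures_eq_maximizers {α β : ℝ} (hα : 0 < α) (hαβ : α < β)
    (h : ∀ ν : ProbabilityMeasure (S d), bilin α ν ν ≤ d / ((d : ℝ) + 1)) :
    simplexEqMeasures d = maximizers d β := by
  have hβ := hα.trans hαβ
  have hle : ∀ ν : ProbabilityMeasure (S d), bilin β ν ν ≤ d / ((d : ℝ) + 1) := fun ν => by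
    refine le_trans ?_ (h ν)
    rw [bilin_eq_integral_prod hα, bilin_eq_integral_prod hβ]
    exact integral_mono (integrable_prod_of_continuous _ _ (continuous_Lambda_rpow hβ))
      (integrable_prod_of_continuous _ _ (continuous_Lambda_rpow hα))
      fun p => Lambda_rpow_anti hα hαβ.le _ _
  ext μ
  rw [mem_maximizers_iff, mem_simplexEqMeasures_iff]
  refine ⟨fun hμ ν => (hle ν).trans_eq (bilin_of_axisEquidistributed hβ hμ).symm, fun hμ => ?_⟩
  obtain ⟨ν, hν⟩ := simplexEqMeasures_nonempty d
  have hν' := hμ ν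
  rw [bilin_of_axisEquidistributed hβ (mem_simplexEqMeasures_iff.1 hν)] at hν'
  exact axisEquidistributed_of_bilin_le hα hαβ (h μ) hν'

lemma bilin_le_of_mem {α : ℝ} (hα : 0 < α) (hs : μ ∈ simplexEqMeasures d)
    (hm : μ ∈ maximizers d α) (ν : ProbabilityMeasure (S d)) :
    bilin α ν ν ≤ d / ((d : ℝ) + 1) :=
  (mem_maximizers_iff.1 hm ν).trans_eq
    (bilin_of_axisEquidistributed hα (mem_simplexEqMeasures_iff.1 hs))

lemma le_bilin_of_mem_maximizers {α : ℝ} (hα : 0 < α) (hm : μ ∈ maximizers d α) :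
    d / ((d : ℝ) + 1) ≤ bilin α μ μ := by
  obtain ⟨ν, hν⟩ := simplexEqMeasures_nonempty d
  rw [← bilin_of_axisEquidistributed hα (mem_simplexEqMeasures_iff.1 hν)]
  exact mem_maximizers_iff.1 hm ν

lemma exists_isThreshold (d : ℕ) : ∃ a, IsThreshold d a := by
  -- Were this set empty, its infimum would be `⊤` and the second clause vacuous.
  refine ⟨sInf {a | ∃ α : ℝ, 0 < α ∧ a = ENNReal.ofReal α ∧
    (simplexEqMeasures d ∩ maximizers d α).Nonempty}, fun α hα hlt => ?_, fun α hα hlt => ?_⟩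
  · rw [Set.disjoint_iff_inter_eq_empty, ← Set.not_nonempty_iff_eq_empty]
    exact fun hne => hlt.not_ge (sInf_le ⟨α, hα, rfl, hne⟩)
  · obtain ⟨_, ⟨β, hβ, rfl, μ, hs, hm⟩, hβα⟩ := sInf_lt_iff.1 hlt
    exact simplexEqMeasures_eq_maximizers hβ
      ((ENNReal.ofReal_lt_ofReal_iff hα).1 hβα) (bilin_le_of_mem hβ hs hm)

lemma exists_real_between {a c : ℝ≥0∞} (h : a < c) :
    ∃ α : ℝ, 0 < α ∧ a < ENNReal.ofReal α ∧ ENNReal.ofReal α < c := by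
  obtain ⟨t, h1, h2⟩ := exists_between h
  have ht : ENNReal.ofReal t.toReal = t := ENNReal.ofReal_toReal (h2.trans_le le_top).ne
  exact ⟨t.toReal, ENNReal.toReal_pos (bot_le.trans_lt h1).ne' (h2.trans_le le_top).ne,
    ht.symm ▸ h1, ht.symm ▸ h2⟩

lemma IsThreshold.not_lt {a c : ℝ≥0∞} (ha : IsThreshold d a) (hc : IsThreshold d c) : ¬ a < c := by
  intro h
  obtain ⟨α, hα, h1, h2⟩ := exists_real_between h
  have hdisj := hc.1 α hα h2
  rw [← ha.2 α hα h1, disjoint_self] at hdisj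
  exact (simplexEqMeasures_nonempty d).ne_empty hdisj

lemma IsThreshold.one_le (hd : 1 ≤ d) {a : ℝ≥0∞} (ha : IsThreshold d a) : 1 ≤ a := by
  by_contra! h
  obtain ⟨α, hα, h1, h2⟩ := exists_real_between h
  obtain ⟨μ, hμ⟩ := simplexEqMeasures_nonempty d
  refine notMem_maximizers_of_lt_one hd hα (ENNReal.ofReal_lt_one.1 h2)
    (mem_simplexEqMeasures_iff.1 hμ) ?_
  rw [← ha.2 α hα h1]
  exact hμ

lemma IsThreshold.lt_top {a : ℝ≥0∞} (ha : IsThreshold d a) : a < ⊤ := by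
  refine lt_of_le_of_lt ?_ (ENNReal.ofReal_lt_top (r := 2))
  by_contra! h
  have hdisj := ha.1 2 two_pos h
  obtain ⟨μ, hμ⟩ := simplexEqMeasures_nonempty d
  refine Set.disjoint_left.1 hdisj hμ (mem_maximizers_iff.2 fun ν => ?_)
  rw [bilin_of_axisEquidistributed two_pos (mem_simplexEqMeasures_iff.1 hμ)]
  exact bilin_two_le ν

lemma exists_radius (d : ℕ) {β : ℝ} (hβ : 0 < β) :
    ∃ r : ℝ, 0 < r ∧ r < 1 / 2 ∧ ((d : ℝ) + 1) * r ≤ 1 / 2 ∧ (2 * r) ^ β ≤ 1 / 8 := by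
  have h1 : Tendsto (fun r : ℝ => ((d : ℝ) + 1) * r) (𝓝[>] 0) (𝓝 0) := by
    have : Continuous fun r : ℝ => ((d : ℝ) + 1) * r := by fun_prop
    simpa using (this.tendsto 0).mono_left nhdsWithin_le_nhds
  have h2 : Tendsto (fun r : ℝ => (2 * r) ^ β) (𝓝[>] 0) (𝓝 0) := by
    have : Continuous fun r : ℝ => (2 * r) ^ β :=
      (continuous_const.mul continuous_id).rpow_const fun _ => Or.inr hβ.le
    simpa [Real.zero_rpow hβ.ne'] using (this.tendsto 0).mono_left nhdsWithin_le_nhds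
  have h3 : Tendsto (fun r : ℝ => r) (𝓝[>] 0) (𝓝 0) := tendsto_id.mono_left nhdsWithin_le_nhds
  obtain ⟨r, ha, hb, hc, hd⟩ := ((h1.eventually_lt_const (by norm_num : (0 : ℝ) < 1 / 2)).and
    ((h2.eventually_lt_const (by norm_num : (0 : ℝ) < 1 / 8)).and
    ((h3.eventually_lt_const (by norm_num : (0 : ℝ) < 1 / 2)).and
      (self_mem_nhdsWithin : Set.Ioi (0 : ℝ) ∈ 𝓝[>] 0)))).exists
  exact ⟨r, hd, hc, ha.le, hb.le⟩

lemma IsThreshold.not_dInftyContinuousAt {a : ℝ≥0∞} (ha : IsThreshold d a) (ha1 : 1 < a)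
    {μ : ℝ → ProbabilityMeasure (S d)} (hμ : ∀ α : ℝ, 0 < α → μ α ∈ maximizers d α) :
    ¬ DInftyContinuousAt μ a.toReal := by
  intro hcont
  have hatop := ha.lt_top.ne
  set t := a.toReal with ht
  have hat : ENNReal.ofReal t = a := ENNReal.ofReal_toReal hatop
  have ht1 : 1 < t := by
    rw [← hat] at ha1
    exact ENNReal.one_lt_ofReal.1 ha1
  -- Local maximality is used at the fixed exponent `α₁`, so that the radius `r` does not depend on
  -- the `α` that approaches `t`.
  set α₁ := (1 + t) / 2 with hα₁
  have hα₁1 : 1 < α₁ := by rw [hα₁]; linarith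
  have hα₁t : α₁ < t := by rw [hα₁]; linarith
  obtain ⟨r, hr0, hr2, hr, hr8⟩ := exists_radius d (sub_pos.2 hα₁1)
  have hev : ∀ᶠ α in 𝓝 t, dInfty (μ α) (μ t) < ENNReal.ofReal (r / 2) :=
    hcont.eventually_lt_const (ENNReal.ofReal_pos.2 (by linarith))
  -- The threshold property is silent at `t` itself. A simplex measure is therefore taken from `β >
  -- t` and compared with `μ α`, `α < t`, through `μ t`, at cost `r / 2` each way.
  obtain ⟨β, hβd, hβ⟩ := ((hev.filter_mono nhdsWithin_le_nhds).and
    (self_mem_nhdsWithin : Set.Ioi t ∈ 𝓝[>] t)).exists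
  obtain ⟨α, hαd, hα⟩ := ((hev.filter_mono nhdsWithin_le_nhds).and
    (Ioo_mem_nhdsLT hα₁t)).exists
  have hβ : t < β := hβ
  have hβ0 : 0 < β := by linarith
  have hα0 : 0 < α := by linarith [hα.1]
  have hβs : AxisEquidistributed (μ β) := by
    rw [← mem_simplexEqMeasures_iff, ha.2 β hβ0 ?_]
    · exact hμ β hβ0
    · rw [← hat]
      exact (ENNReal.ofReal_lt_ofReal_iff hβ0).2 hβ
  obtain ⟨b, hb⟩ := hβs
  have hmass : ∀ i, ((d : ℝ≥0∞) + 1)⁻¹ ≤ (μ α : Measure (S d)) (axisNbhd b i r) := fun i => by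
    have h1 := measure_le_of_dInfty_lt hβd (measurableSet_axisNbhd (b := b) i 0)
      (measurableSet_axisNbhd i (0 + r / 2)) fun x y h hx => mem_axisNbhd_add h hx
    have h2 := measure_le_of_dInfty_lt' hαd (measurableSet_axisNbhd (b := b) i (0 + r / 2))
      (measurableSet_axisNbhd i (0 + r / 2 + r / 2)) fun x y h hx => mem_axisNbhd_add h hx
    rw [zero_add, add_halves] at h2
    rw [zero_add] at h1
    exact (hb i).trans (h1.trans h2)
  have hαs : AxisEquidistributed (μ α) :=
    axisEquidistributed_of_bilin_le (by linarith) hα.1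
      (bilin_le_of_axisNbhd hα₁1 hr hr2 hr8 hmass) (le_bilin_of_mem_maximizers hα0 (hμ α hα0))
  refine Set.disjoint_left.1 (ha.1 α hα0 ?_) (mem_simplexEqMeasures_iff.2 hαs) (hμ α hα0)
  rw [← hat]
  exact (ENNReal.ofReal_lt_ofReal_iff (by linarith)).2 hα.2

end

end ProjectiveAngle

end

theorem corollary2p5 (d : ℕ) (hd : 1 ≤ d) :
    (∃! a : ENNReal, ProjectiveAngle.IsThreshold d a) ∧
    ∀ a : ENNReal, ProjectiveAngle.IsThreshold d a →
      1 ≤ a ∧ a < ⊤ ∧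
      ∀ μ : ℝ → MeasureTheory.ProbabilityMeasure (ProjectiveAngle.S d),
        (∀ α : ℝ, 0 < α → μ α ∈ ProjectiveAngle.maximizers d α) →
        a ≠ 1 → ¬ ProjectiveAngle.DInftyContinuousAt μ a.toReal := by
  obtain ⟨a₀, ha₀⟩ := ProjectiveAngle.exists_isThreshold d
  refine ⟨⟨a₀, ha₀, fun c hc => le_antisymm (not_lt.1 (ha₀.not_lt hc)) (not_lt.1 (hc.not_lt ha₀))⟩,
    fun a ha => ⟨ha.one_le hd, ha.lt_top, fun μ hμ hne => ?_⟩⟩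
  exact ha.not_dInftyContinuousAt (lt_of_le_of_ne (ha.one_le hd) hne.symm) hμ
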